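/- A linear $[n,k]$ code over a finite field $\mathbb{F}_q$ is a $k$-dimensional subspace $\mathcal{C}$ of $\mathbb{F}_q^n$; it is an $[n,k,d]$ code if moreover the minimum Hamming distance between two distinct codewords of $\mathcal{C}$ equals $d$. A generator matrix of $\mathcal{C}$ is a matrix whose rows form a basis of $\mathcal{C}$. The Euclidean dual is $\mathcal{C}^\perp=\{\mathbf{x}\in\mathbb{F}_q^n : \sum_{i=1}^n x_ic_i=0 \text{ for all } \mathbf{c}\in\mathcal{C}\}$, and $\mathcal{C}$ is called an LCD code if $\mathcal{C}\cap\mathcal{C}^\perp=\{\mathbf{0}\}$. An $[n,k]$ LCD code is called an optimal LCD code if its minimum distance is the largest among all $[n,k]$ LCD codes over $\mathbb{F}_q$. Ternary means $q=3$. There exists a ternary optimal LCD $[23,4,14]$ code. There also exist ternary LCD codes with parameters $[23,5,12]$, $[24,6,12]$ and $[25,5,14]$. More precisely, consider the following matrices over $\mathbb{F}_3$: \[ G_1=\left[\begin{array}{*{23}{c}} 1&0&0&0&2&1&1&2&0&1&0&0&1&2&1&0&1&1&1&1&1&2&1\\ 0&1&0&0&2&2&2&1&2&0&0&2&1&1&1&1&1&0&0&2&0&1&0\\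 0&0&1&0&2&1&0&1&2&1&1&2&0&2&2&2&0&1&0&0&2&1&2\\ 0&0&0&1&0&2&0&2&1&1&1&2&2&2&0&1&1&0&1&2&1&0&2 \end{array}\right], \] \[ G_2=\left[\begin{array}{*{23}{c}} 1&0&0&0&2&1&1&2&0&1&0&0&1&2&1&0&1&1&1&0&0&2&2\\ 0&1&0&0&2&2&2&1&2&0&0&2&1&1&1&1&1&0&0&2&0&1&1\\ 0&0&1&0&2&1&0&1&2&1&1&2&0&2&2&2&0&1&0&0&2&0&2\\ 0&0&0&1&0&2&0&2&1&1&1&2&2&2&0&1&1&0&1&2&1&0&2\\ 0&0&0&0&1&1&1&1&0&2&1&1&2&0&0&1&0&1&1&1&2&2&2 \end{array}\right], \] \[ G_3=\left[\begin{array}{*{24}{c}} 1&0&0&0&0&2&2&1&1&0&0&2&0&2&1&1&2&2&2&0&0&0&0&1\\ 0&1&0&2&0&1&0&0&2&0&2&1&1&0&2&1&2&1&0&2&2&2&2&1\\ 0&0&1&2&0&0&1&2&2&2&0&2&1&0&2&0&2&0&1&1&1&0&2&0\\ 0&0&0&0&1&1&1&1&2&2&2&2&1&1&1&1&0&0&0&0&0&1&1&1\\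 0&0&0&1&0&2&0&1&1&1&0&0&2&1&0&2&0&0&1&1&0&1&0&2\\ 0&0&0&0&0&0&1&2&1&1&0&1&1&1&0&1&2&2&0&2&1&1&0&2 \end{array}\right], \] \[ G_4=\left[\begin{array}{*{25}{c}} 1&0&0&0&0&2&2&0&0&0&1&1&0&2&1&1&1&2&2&1&2&1&0&2&0\\ 0&1&0&0&0&0&0&2&2&2&1&0&0&1&1&2&1&1&1&1&1&2&1&2&1\\ 0&0&1&0&0&2&1&2&2&0&2&0&2&2&2&0&0&2&1&1&2&0&2&0&0\\ 0&0&0&1&0&2&0&2&1&1&1&2&2&2&0&1&1&0&1&0&0&2&1&0&0\\ 0&0&0&0&1&1&1&1&0&2&1&1&2&0&0&1&0&1&1&1&2&1&2&2&2 \end{array}\right]. \] Then $G_1$ is a generator matrix of a ternary optimal LCD $[23,4,14]$ code, and $G_2$, $G_3$, $G_4$ are generator matrices of ternary LCD codes with parameters $[23,5,12]$, $[24,6,12]$ and $[25,5,14]$, respectively. -/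

import Mathlib

open Matrix

namespace LCDCode

/-- The Euclidean dual of a linear code `C` of length `n`. -/
def euclideanDual {F : Type*} [Field F] {n : ℕ} (C : Submodule F (Fin n → F)) :
    Submodule F (Fin n → F) where
  carrier := {x | ∀ c ∈ C, x ⬝ᵥ c = 0}
  zero_mem' := fun c _ => zero_dotProduct c
  add_mem' := fun hx hy c hc => by rw [add_dotProduct, hx c hc, hy c hc, add_zero]
  smul_mem' := fun a x hx c hc => by rw [smul_dotProduct, hx c hc, smul_zero]

/-- The Euclidean hull of a linear code. -/
def hull {F : Type*} [Field F] {n : ℕ} (C : Submodule F (Fin n → F)) :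
    Submodule F (Fin n → F) :=
  C ⊓ euclideanDual C

/-- A (Euclidean) LCD code: the hull is zero. -/
def IsLCD {F : Type*} [Field F] {n : ℕ} (C : Submodule F (Fin n → F)) : Prop :=
  hull C = ⊥

/-- `d` is the minimum of the Hamming distances between two distinct codewords of `C`. -/
def HasMinDist {F : Type*} [Field F] [DecidableEq F] {n : ℕ}
    (C : Submodule F (Fin n → F)) (d : ℕ) : Prop :=
  IsLeast {w : ℕ | ∃ u ∈ C, ∃ v ∈ C, u ≠ v ∧ hammingDist u v = w} d

/-- `C` is a linear LCD code with parameters `[n, k, d]`. -/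
def IsLCDCode {F : Type*} [Field F] [DecidableEq F] (n k d : ℕ)
    (C : Submodule F (Fin n → F)) : Prop :=
  IsLCD C ∧ Module.finrank F C = k ∧ HasMinDist C d

/-- `C` is an optimal LCD code with parameters `[n, k, d]`: its minimum distance `d` is the
largest among all LCD codes of length `n` and dimension `k` over `F`. -/
def IsOptimalLCDCode {F : Type*} [Field F] [DecidableEq F] (n k d : ℕ)
    (C : Submodule F (Fin n → F)) : Prop :=
  IsLCDCode n k d C ∧
    ∀ (C' : Submodule F (Fin n → F)) (d' : ℕ), IsLCDCode n k d' C' → d' ≤ d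

/-- The rows of `G` form a basis of the code `C`. -/
def IsGeneratorMatrix {F : Type*} [Field F] {k n : ℕ} (G : Matrix (Fin k) (Fin n) F)
    (C : Submodule F (Fin n → F)) : Prop :=
  LinearIndependent F G.row ∧ Submodule.span F (Set.range G.row) = C

/-- The generator matrix of the `[23, 4]` code. -/
def G1 : Matrix (Fin 4) (Fin 23) (ZMod 3) :=
  !![1, 0, 0, 0, 2, 1, 1, 2, 0, 1, 0, 0, 1, 2, 1, 0, 1, 1, 1, 1, 1, 2, 1;
     0, 1, 0, 0, 2, 2, 2, 1, 2, 0, 0, 2, 1, 1, 1, 1, 1, 0, 0, 2, 0, 1, 0;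
     0, 0, 1, 0, 2, 1, 0, 1, 2, 1, 1, 2, 0, 2, 2, 2, 0, 1, 0, 0, 2, 1, 2;
     0, 0, 0, 1, 0, 2, 0, 2, 1, 1, 1, 2, 2, 2, 0, 1, 1, 0, 1, 2, 1, 0, 2]

/-- The generator matrix of the `[23, 5]` code. -/
def G2 : Matrix (Fin 5) (Fin 23) (ZMod 3) :=
  !![1, 0, 0, 0, 2, 1, 1, 2, 0, 1, 0, 0, 1, 2, 1, 0, 1, 1, 1, 0, 0, 2, 2;
     0, 1, 0, 0, 2, 2, 2, 1, 2, 0, 0, 2, 1, 1, 1, 1, 1, 0, 0, 2, 0, 1, 1;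
     0, 0, 1, 0, 2, 1, 0, 1, 2, 1, 1, 2, 0, 2, 2, 2, 0, 1, 0, 0, 2, 0, 2;
     0, 0, 0, 1, 0, 2, 0, 2, 1, 1, 1, 2, 2, 2, 0, 1, 1, 0, 1, 2, 1, 0, 2;
     0, 0, 0, 0, 1, 1, 1, 1, 0, 2, 1, 1, 2, 0, 0, 1, 0, 1, 1, 1, 2, 2, 2]

/-- The generator matrix of the `[24, 6]` code. -/
def G3 : Matrix (Fin 6) (Fin 24) (ZMod 3) :=
  !![1, 0, 0, 0, 0, 2, 2, 1, 1, 0, 0, 2, 0, 2, 1, 1, 2, 2, 2, 0, 0, 0, 0, 1;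
     0, 1, 0, 2, 0, 1, 0, 0, 2, 0, 2, 1, 1, 0, 2, 1, 2, 1, 0, 2, 2, 2, 2, 1;
     0, 0, 1, 2, 0, 0, 1, 2, 2, 2, 0, 2, 1, 0, 2, 0, 2, 0, 1, 1, 1, 0, 2, 0;
     0, 0, 0, 0, 1, 1, 1, 1, 2, 2, 2, 2, 1, 1, 1, 1, 0, 0, 0, 0, 0, 1, 1, 1;
     0, 0, 0, 1, 0, 2, 0, 1, 1, 1, 0, 0, 2, 1, 0, 2, 0, 0, 1, 1, 0, 1, 0, 2;
     0, 0, 0, 0, 0, 0, 1, 2, 1, 1, 0, 1, 1, 1, 0, 1, 2, 2, 0, 2, 1, 1, 0, 2]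

/-- The generator matrix of the `[25, 5]` code. -/
def G4 : Matrix (Fin 5) (Fin 25) (ZMod 3) :=
  !![1, 0, 0, 0, 0, 2, 2, 0, 0, 0, 1, 1, 0, 2, 1, 1, 1, 2, 2, 1, 2, 1, 0, 2, 0;
     0, 1, 0, 0, 0, 0, 0, 2, 2, 2, 1, 0, 0, 1, 1, 2, 1, 1, 1, 1, 1, 2, 1, 2, 1;
     0, 0, 1, 0, 0, 2, 1, 2, 2, 0, 2, 0, 2, 2, 2, 0, 0, 2, 1, 1, 2, 0, 2, 0, 0;
     0, 0, 0, 1, 0, 2, 0, 2, 1, 1, 1, 2, 2, 2, 0, 1, 1, 0, 1, 0, 0, 2, 1, 0, 0;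
     0, 0, 0, 0, 1, 1, 1, 1, 0, 2, 1, 1, 2, 0, 0, 1, 0, 1, 1, 1, 2, 1, 2, 2, 2]

end LCDCode

/-!
A code with generator matrix `G` is LCD as soon as the Gram matrix `G * Gᵀ` is invertible (Massey),
and its minimum distance is found by running through all messages.

Optimality of the `[23, 4, 14]` code rests on the fact that every ternary `[23, 4]` code has a
nonzero word of weight at most `14`. Otherwise the Griesmer bound, applied to the residual code of
a word `a` of weight `w`, leaves only `w = 15`, `w = 18` and `w = 23`. For `w = 18` the residual
code would be a `[5, 3]` code of minimum distance at least `3`, in which the same bound allows only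
the weights `3` and `5`. In both codes, summing the weights along a line `b + t • a` rules out a
word `a` without zero coordinates, so the weight is constant. But the constant weight of a ternary
code of dimension `k` is divisible by `3 ^ (k - 1)`, whereas `27 ∤ 15` and `9 ∤ 3`.
-/

open scoped Finset

namespace LCDCode

section ResidualCode

variable {F ι : Type*} [Field F] {a b : ι → F} {C : Submodule F (ι → F)}

/-- Deletion of the coordinates in the support of `a`, leaving the coordinates at which `a`
vanishes. -/
def punctureSupport (a : ι → F) : (ι → F) →ₗ[F] ({i // a i = 0} → F) :=
  LinearMap.funLeft F F Subtype.val

/-- The residual code of `C` with respect to the word `a`: the code `C` punctured at the support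
of `a`. -/
def residualCode (C : Submodule F (ι → F)) (a : ι → F) : Submodule F ({i // a i = 0} → F) :=
  C.map (punctureSupport a)

theorem punctureSupport_eq_zero_of_mem_span_singleton (hb : b ∈ Submodule.span F {a}) :
    punctureSupport a b = 0 := by
  obtain ⟨t, rfl⟩ := Submodule.mem_span_singleton.1 hb
  ext i
  simp [punctureSupport, i.2]

theorem add_smul_ne_zero_of_notMem_span_singleton (hb : b ∉ Submodule.span F {a}) (t : F) :
    b + t • a ≠ 0 := fun h =>
  hb (Submodule.mem_span_singleton.2 ⟨-t, by rw [neg_smul, ← eq_neg_of_add_eq_zero_left h]⟩)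

theorem exists_notMem_span_singleton_of_mem_residualCode {r : {i // a i = 0} → F}
    (hr : r ∈ residualCode C a) (hr0 : r ≠ 0) :
    ∃ b ∈ C, b ∉ Submodule.span F {a} ∧ punctureSupport a b = r := by
  obtain ⟨b, hb, rfl⟩ := hr
  exact ⟨b, hb, fun h => hr0 (punctureSupport_eq_zero_of_mem_span_singleton h), rfl⟩

variable [DecidableEq F] [Fintype ι]

theorem card_zeros_add_hammingNorm (a : ι → F) :
    Fintype.card {i // a i = 0} + hammingNorm a = Fintype.card ι := by
  rw [Fintype.card_subtype, hammingNorm, Finset.card_filter_add_card_filter_not, Finset.card_univ]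

theorem hammingNorm_punctureSupport (a b : ι → F) :
    hammingNorm (punctureSupport a b) = #{i | a i = 0 ∧ b i ≠ 0} := by
  rw [hammingNorm, ← Fintype.card_subtype, ← Fintype.card_subtype]
  exact Fintype.card_congr (Equiv.subtypeSubtypeEquivSubtypeInter (a · = 0) (b · ≠ 0))

variable [Fintype F]

theorem card_filter_add_mul_ne_zero (x y : F) :
    #{t : F | y + t * x ≠ 0} =
      (Fintype.card F - 1) * (if x ≠ 0 then 1 else 0) +
        Fintype.card F * (if x = 0 ∧ y ≠ 0 then 1 else 0) := by
  by_cases hx : x = 0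
  · by_cases hy : y = 0 <;> simp [hx, hy]
  · have hroot : ({t : F | y + t * x ≠ 0} : Finset F) = {-y / x}ᶜ := by
      ext t
      simp [eq_div_iff hx, eq_neg_iff_add_eq_zero, add_comm]
    simp [hroot, hx, Finset.card_compl]

theorem sum_hammingNorm_add_smul (a b : ι → F) :
    ∑ t : F, hammingNorm (b + t • a) =
      (Fintype.card F - 1) * hammingNorm a +
        Fintype.card F * hammingNorm (punctureSupport a b) := by
  calc ∑ t : F, hammingNorm (b + t • a)
      = ∑ i, #{t : F | b i + t * a i ≠ 0} := by
        simp only [hammingNorm, Finset.card_filter, Pi.add_apply, Pi.smul_apply, smul_eq_mul]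
        exact Finset.sum_comm
    _ = _ := by
        simp only [card_filter_add_mul_ne_zero, Finset.sum_add_distrib, ← Finset.mul_sum,
          ← Finset.card_filter]
        rw [hammingNorm_punctureSupport, hammingNorm]

variable {d : ℕ}

theorem card_mul_le_of_notMem_span_singleton (hd : ∀ c ∈ C, c ≠ 0 → d ≤ hammingNorm c)
    (ha : a ∈ C) (hb : b ∈ C) (hab : b ∉ Submodule.span F {a}) :
    Fintype.card F * d ≤
      (Fintype.card F - 1) * hammingNorm a +
        Fintype.card F * hammingNorm (punctureSupport a b) := by
  calc Fintype.card F * d = ∑ _t : F, d := by simp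
    _ ≤ ∑ t : F, hammingNorm (b + t • a) := Finset.sum_le_sum fun t _ =>
        hd _ (add_mem hb (C.smul_mem t ha)) (add_smul_ne_zero_of_notMem_span_singleton hab t)
    _ = _ := sum_hammingNorm_add_smul a b

theorem ceilDiv_le_hammingNorm_of_mem_residualCode (hd : ∀ c ∈ C, c ≠ 0 → d ≤ hammingNorm c)
    (ha : a ∈ C) {r : {i // a i = 0} → F} (hr : r ∈ residualCode C a) (hr0 : r ≠ 0) :
    (Fintype.card F * d - (Fintype.card F - 1) * hammingNorm a) ⌈/⌉ Fintype.card F ≤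
      hammingNorm r := by
  obtain ⟨b, hb, hab, rfl⟩ := exists_notMem_span_singleton_of_mem_residualCode hr hr0
  rw [ceilDiv_le_iff_le_mul Fintype.card_pos, tsub_le_iff_left]
  exact card_mul_le_of_notMem_span_singleton hd ha hb hab

theorem finrank_residualCode_add_one (hd : ∀ c ∈ C, c ≠ 0 → d ≤ hammingNorm c) (ha : a ∈ C)
    (ha0 : a ≠ 0) (had : (Fintype.card F - 1) * hammingNorm a < Fintype.card F * d) :
    Module.finrank F (residualCode C a) + 1 = Module.finrank F C := by
  have hker : ((punctureSupport a).domRestrict C).ker = Submodule.span F {⟨a, ha⟩} := by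
    ext ⟨b, hb⟩
    have hspan : (⟨b, hb⟩ : C) ∈ Submodule.span F {⟨a, ha⟩} ↔ b ∈ Submodule.span F {a} := by
      simp only [Submodule.mem_span_singleton, Subtype.ext_iff, Submodule.coe_smul]
    rw [LinearMap.mem_ker, LinearMap.domRestrict_apply, hspan]
    refine ⟨fun h => ?_, punctureSupport_eq_zero_of_mem_span_singleton⟩
    by_contra hab
    have := card_mul_le_of_notMem_span_singleton hd ha hb hab
    rw [h, hammingNorm_zero] at this
    omega
  have hrank := ((punctureSupport a).domRestrict C).finrank_range_add_finrank_ker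
  rwa [hker, finrank_span_singleton (by simpa [Subtype.ext_iff] using ha0),
    LinearMap.range_domRestrict] at hrank

end ResidualCode

section GriesmerBound

theorem card_mul_eq_card_sub_one_mul_add (F : Type*) [Fintype F] [Nonempty F] (w : ℕ) :
    Fintype.card F * w = (Fintype.card F - 1) * w + w := by
  rw [← Nat.succ_mul, Nat.succ_eq_add_one, Nat.sub_add_cancel Fintype.card_pos]

theorem ceilDiv_ceilDiv_eq_ceilDiv_mul {a b : ℕ} (ha : 0 < a) (hb : 0 < b) (n : ℕ) :
    n ⌈/⌉ a ⌈/⌉ b = n ⌈/⌉ (a * b) :=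
  eq_of_forall_ge_iff fun m => by
    simp only [ceilDiv_le_iff_le_mul, ha, hb, mul_pos ha hb, mul_assoc]

variable {F ι : Type*} [Field F] [DecidableEq F] [Fintype F] [Fintype ι]
  {C : Submodule F (ι → F)} {d : ℕ}

theorem griesmer_bound (hd : ∀ c ∈ C, c ≠ 0 → d ≤ hammingNorm c) :
    ∑ i ∈ Finset.range (Module.finrank F C), d ⌈/⌉ Fintype.card F ^ i ≤ Fintype.card ι := by
  induction hk : Module.finrank F C generalizing ι d with
  | zero => simp
  | succ k ih =>
    have hC : C ≠ ⊥ := by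
      rintro rfl
      simp at hk
    obtain ⟨a, ⟨ha, ha0⟩, hmin⟩ := Set.exists_min_image {c | c ∈ C ∧ c ≠ 0} hammingNorm
      (Set.toFinite _) (C.exists_mem_ne_zero_of_ne_bot hC)
    have hmin : ∀ c ∈ C, c ≠ 0 → hammingNorm a ≤ hammingNorm c := fun c hc hc0 =>
      hmin c ⟨hc, hc0⟩
    have hq : 0 < Fintype.card F := Fintype.card_pos
    have hexcess := card_mul_eq_card_sub_one_mul_add F (hammingNorm a)
    have hrank := finrank_residualCode_add_one hmin ha ha0
      (by have := hammingNorm_pos_iff.2 ha0; omega)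
    have hres : ∀ r ∈ residualCode C a, r ≠ 0 →
        hammingNorm a ⌈/⌉ Fintype.card F ≤ hammingNorm r := fun r hr hr0 => by
      simpa [hexcess] using ceilDiv_le_hammingNorm_of_mem_residualCode hmin ha hr hr0
    calc ∑ i ∈ Finset.range (k + 1), d ⌈/⌉ Fintype.card F ^ i
        ≤ ∑ i ∈ Finset.range (k + 1), hammingNorm a ⌈/⌉ Fintype.card F ^ i :=
          Finset.sum_le_sum fun i _ =>
            (gc_mul_ceilDiv (pow_pos hq i)).monotone_l (hd a ha ha0)
      _ = ∑ i ∈ Finset.range k, hammingNorm a ⌈/⌉ Fintype.card F ⌈/⌉ Fintype.card F ^ i +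
            hammingNorm a := by
          simp only [Finset.sum_range_succ', pow_succ', pow_zero, ceilDiv_one,
            ceilDiv_ceilDiv_eq_ceilDiv_mul hq (pow_pos hq _)]
      _ ≤ Fintype.card {i // a i = 0} + hammingNorm a :=
          Nat.add_le_add_right (ih hres (by omega)) _
      _ = Fintype.card ι := card_zeros_add_hammingNorm a

theorem hammingNorm_add_sum_ceilDiv_le (hd : ∀ c ∈ C, c ≠ 0 → d ≤ hammingNorm c) {a : ι → F}
    (ha : a ∈ C) (ha0 : a ≠ 0)
    (had : (Fintype.card F - 1) * hammingNorm a < Fintype.card F * d) :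
    hammingNorm a + ∑ i ∈ Finset.range (Module.finrank F C - 1),
      (Fintype.card F * d - (Fintype.card F - 1) * hammingNorm a) ⌈/⌉ Fintype.card F ^ (i + 1) ≤
      Fintype.card ι := by
  have hq : 0 < Fintype.card F := Fintype.card_pos
  have hbound := griesmer_bound fun r hr hr0 =>
    ceilDiv_le_hammingNorm_of_mem_residualCode hd ha (r := r) hr hr0
  simp only [ceilDiv_ceilDiv_eq_ceilDiv_mul hq (pow_pos hq _), ← pow_succ'] at hbound
  rw [← finrank_residualCode_add_one hd ha ha0 had, Nat.add_sub_cancel]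
  have := card_zeros_add_hammingNorm a
  omega

end GriesmerBound

section ConstantWeight

variable {F ι : Type*} [Field F] [DecidableEq F] [Fintype F] [Fintype ι]
  {C : Submodule F (ι → F)} {w : ℕ}

theorem card_pow_finrank_sub_one_dvd_of_forall_hammingNorm_eq
    (hw : ∀ c ∈ C, c ≠ 0 → hammingNorm c = w) :
    Fintype.card F ^ (Module.finrank F C - 1) ∣ w := by
  induction hk : Module.finrank F C - 1 generalizing ι w with
  | zero => simp
  | succ k ih =>
    have hC : C ≠ ⊥ := by
      rintro rfl
      simp at hk
    obtain ⟨a, ha, ha0⟩ := C.exists_mem_ne_zero_of_ne_bot hC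
    have hq : 0 < Fintype.card F := Fintype.card_pos
    have hexcess := card_mul_eq_card_sub_one_mul_add F w
    have hrank := finrank_residualCode_add_one (fun c hc hc0 => (hw c hc hc0).ge) ha ha0
      (by have := hammingNorm_pos_iff.2 ha0; rw [hw a ha ha0] at *; omega)
    have hres : ∀ r ∈ residualCode C a, r ≠ 0 → w = Fintype.card F * hammingNorm r := by
      intro r hr hr0
      obtain ⟨b, hb, hab, rfl⟩ := exists_notMem_span_singleton_of_mem_residualCode hr hr0
      have hline : ∀ t : F, hammingNorm (b + t • a) = w := fun t =>
        hw _ (add_mem hb (C.smul_mem t ha)) (add_smul_ne_zero_of_notMem_span_singleton hab t)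
      have hsum := sum_hammingNorm_add_smul a b
      simp only [hline, Finset.sum_const, Finset.card_univ, smul_eq_mul, hw a ha ha0] at hsum
      omega
    have hres_ne_bot : residualCode C a ≠ ⊥ := by
      intro h
      rw [h, finrank_bot] at hrank
      omega
    obtain ⟨s, hs, hs0⟩ := (residualCode C a).exists_mem_ne_zero_of_ne_bot hres_ne_bot
    have hconst : ∀ r ∈ residualCode C a, r ≠ 0 → hammingNorm r = hammingNorm s :=
      fun r hr hr0 => Nat.eq_of_mul_eq_mul_left hq ((hres r hr hr0).symm.trans (hres s hs hs0))
    rw [hres s hs hs0, pow_succ']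
    exact mul_dvd_mul_left _ (ih hconst (by omega))

end ConstantWeight

section Ternary

variable {ι : Type*} [Fintype ι] {C : Submodule (ZMod 3) (ι → ZMod 3)} {d : ℕ}

theorem three_pow_finrank_sub_one_dvd_of_forall_hammingNorm_eq_or_eq_card
    (hC : 2 ≤ Module.finrank (ZMod 3) C)
    (hw : ∀ c ∈ C, c ≠ 0 → hammingNorm c = d ∨ hammingNorm c = Fintype.card ι)
    (h2 : 2 * d ≠ Fintype.card ι) (h3 : 3 * d ≠ 2 * Fintype.card ι) :
    3 ^ (Module.finrank (ZMod 3) C - 1) ∣ d := by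
  obtain rfl | hd := d.eq_zero_or_pos
  · exact dvd_zero _
  suffices hconst : ∀ c ∈ C, c ≠ 0 → hammingNorm c = d by
    simpa only [ZMod.card] using card_pow_finrank_sub_one_dvd_of_forall_hammingNorm_eq hconst
  intro a ha ha0
  refine (hw a ha ha0).resolve_right fun hfull => ?_
  obtain ⟨b, hb, hab⟩ : ∃ b ∈ C, b ∉ Submodule.span (ZMod 3) {a} := by
    refine SetLike.not_le_iff_exists.1 fun hle => ?_
    have := Submodule.finrank_mono hle
    rw [finrank_span_singleton ha0] at this
    omega
  have hpuncture : hammingNorm (punctureSupport a b) = 0 := by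
    have hzeros := card_zeros_add_hammingNorm a
    have hle : hammingNorm (punctureSupport a b) ≤ Fintype.card {i // a i = 0} :=
      hammingNorm_le_card_fintype
    omega
  have hsum : hammingNorm (b + (0 : ZMod 3) • a) + hammingNorm (b + (1 : ZMod 3) • a) +
      hammingNorm (b + (2 : ZMod 3) • a) = 2 * Fintype.card ι := by
    have h := sum_hammingNorm_add_smul a b
    rw [ZMod.card, hpuncture, hfull, mul_zero, add_zero] at h
    exact (Fin.sum_univ_three fun t : ZMod 3 => hammingNorm (b + t • a)).symm.trans h
  have hline : ∀ t : ZMod 3,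
      hammingNorm (b + t • a) = d ∨ hammingNorm (b + t • a) = Fintype.card ι := fun t =>
    hw _ (add_mem hb (C.smul_mem t ha)) (add_smul_ne_zero_of_notMem_span_singleton hab t)
  -- If `j` of the three weights equal `n = Fintype.card ι`, then `(3 - j) * d + j * n = 2 * n`:
  -- this contradicts `h3` for `j = 0`, `h2` for `j = 1`, and `0 < d`, `0 < n` for `j ≥ 2`.
  have := hammingNorm_pos_iff.2 ha0
  have := hline 0
  have := hline 1
  have := hline 2
  omega

theorem exists_hammingNorm_lt_three_of_finrank_eq_three (hι : Fintype.card ι = 5)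
    (hC : Module.finrank (ZMod 3) C = 3) : ∃ c ∈ C, c ≠ 0 ∧ hammingNorm c < 3 := by
  by_contra! hd
  have hweight : ∀ c ∈ C, c ≠ 0 → hammingNorm c = 3 ∨ hammingNorm c = Fintype.card ι := by
    intro c hc hc0
    have hge := hd c hc hc0
    have hle := hammingNorm_le_card_fintype (x := c)
    have hgriesmer := hammingNorm_add_sum_ceilDiv_le hd hc hc0
    rw [hC, hι, ZMod.card] at hgriesmer
    rw [hι] at hle ⊢
    generalize hammingNorm c = w at *
    interval_cases w <;>
      simp [Finset.sum_range_succ, Nat.ceilDiv_eq_add_pred_div] at hgriesmer ⊢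
  have hdvd := three_pow_finrank_sub_one_dvd_of_forall_hammingNorm_eq_or_eq_card (by omega) hweight
    (by omega) (by omega)
  rw [hC] at hdvd
  omega

theorem hammingNorm_ne_eighteen (hι : Fintype.card ι = 23)
    (hC : Module.finrank (ZMod 3) C = 4) (hd : ∀ c ∈ C, c ≠ 0 → 15 ≤ hammingNorm c)
    {a : ι → ZMod 3} (ha : a ∈ C) : hammingNorm a ≠ 18 := by
  intro hw
  have ha0 : a ≠ 0 := hammingNorm_ne_zero_iff.1 (by omega)
  have hzeros := card_zeros_add_hammingNorm a
  have hrank := finrank_residualCode_add_one hd ha ha0 (by simp [hw])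
  obtain ⟨r, hr, hr0, hlt⟩ :=
    exists_hammingNorm_lt_three_of_finrank_eq_three (C := residualCode C a) (by omega) (by omega)
  have hge := ceilDiv_le_hammingNorm_of_mem_residualCode hd ha hr hr0
  rw [hw, ZMod.card, Nat.ceilDiv_eq_add_pred_div] at hge
  omega

theorem exists_hammingNorm_lt_fifteen_of_finrank_eq_four (hι : Fintype.card ι = 23)
    (hC : Module.finrank (ZMod 3) C = 4) : ∃ c ∈ C, c ≠ 0 ∧ hammingNorm c < 15 := by
  by_contra! hd
  have hweight : ∀ c ∈ C, c ≠ 0 → hammingNorm c = 15 ∨ hammingNorm c = Fintype.card ι := by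
    intro c hc hc0
    have hge := hd c hc hc0
    have hle := hammingNorm_le_card_fintype (x := c)
    have hne := hammingNorm_ne_eighteen hι hC hd hc
    have hgriesmer := hammingNorm_add_sum_ceilDiv_le hd hc hc0
    rw [hC, hι, ZMod.card] at hgriesmer
    rw [hι] at hle ⊢
    generalize hammingNorm c = w at *
    interval_cases w <;>
      simp [Finset.sum_range_succ, Nat.ceilDiv_eq_add_pred_div] at hgriesmer hne ⊢
  have hdvd := three_pow_finrank_sub_one_dvd_of_forall_hammingNorm_eq_or_eq_card (by omega) hweight
    (by omega) (by omega)
  rw [hC] at hdvd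
  omega

end Ternary

section MinimumDistance

variable {F : Type*} [Field F] [DecidableEq F] {n d : ℕ} {C : Submodule F (Fin n → F)}

theorem hasMinDist_iff_isLeast_hammingNorm :
    HasMinDist C d ↔ IsLeast {w | ∃ c ∈ C, c ≠ 0 ∧ hammingNorm c = w} d := by
  suffices h : {w | ∃ u ∈ C, ∃ v ∈ C, u ≠ v ∧ hammingDist u v = w} =
      {w | ∃ c ∈ C, c ≠ 0 ∧ hammingNorm c = w} by rw [HasMinDist, h]
  ext w
  constructor
  · rintro ⟨u, hu, v, hv, huv, rfl⟩
    refine ⟨-u + v, add_mem (neg_mem hu) hv, ?_, (hammingDist_eq_hammingNorm u v).symm⟩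
    rwa [neg_add_eq_sub, sub_ne_zero, ne_comm]
  · rintro ⟨c, hc, hc0, rfl⟩
    exact ⟨c, hc, 0, zero_mem C, hc0, hammingDist_zero_right c⟩

theorem le_fourteen_of_hasMinDist {C : Submodule (ZMod 3) (Fin 23 → ZMod 3)}
    (hC : Module.finrank (ZMod 3) C = 4) (hd : HasMinDist C d) : d ≤ 14 := by
  obtain ⟨c, hc, hc0, hlt⟩ :=
    exists_hammingNorm_lt_fifteen_of_finrank_eq_four (Fintype.card_fin 23) hC
  have := (hasMinDist_iff_isLeast_hammingNorm.1 hd).2 ⟨c, hc, hc0, rfl⟩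
  omega

end MinimumDistance

section GeneratorMatrix

variable {F m : Type*} [Field F] [Fintype m] {n : ℕ}

theorem mem_span_range_row_iff {G : Matrix m (Fin n) F} {x : Fin n → F} :
    x ∈ Submodule.span F (Set.range G.row) ↔ ∃ y, y ᵥ* G = x := by
  rw [← range_vecMulLinear]
  rfl

theorem hasMinDist_span_row [DecidableEq F] {d : ℕ} {G : Matrix m (Fin n) F}
    (hG : LinearIndependent F G.row) (hle : ∀ y ≠ 0, d ≤ hammingNorm (y ᵥ* G))
    (hattained : ∃ y ≠ 0, hammingNorm (y ᵥ* G) = d) :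
    HasMinDist (Submodule.span F (Set.range G.row)) d := by
  rw [hasMinDist_iff_isLeast_hammingNorm]
  constructor
  · obtain ⟨y, hy, hyd⟩ := hattained
    refine ⟨y ᵥ* G, mem_span_range_row_iff.2 ⟨y, rfl⟩, fun h => hy ?_, hyd⟩
    exact vecMul_injective_iff.2 hG (h.trans (zero_vecMul G).symm)
  · rintro _ ⟨_, hc, hc0, rfl⟩
    obtain ⟨y, rfl⟩ := mem_span_range_row_iff.1 hc
    refine hle y ?_
    rintro rfl
    exact hc0 (zero_vecMul G)

variable [DecidableEq m]

theorem eq_zero_of_mulVec_vecMul_eq_zero {G : Matrix m (Fin n) F} (hG : IsUnit (G * Gᵀ))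
    {y : m → F} (hy : G *ᵥ (y ᵥ* G) = 0) : y = 0 := by
  refine mulVec_injective_of_isUnit hG ?_
  rw [mulVec_zero, ← mulVec_mulVec, mulVec_transpose, hy]

theorem linearIndependent_row_of_isUnit_gram {G : Matrix m (Fin n) F} (hG : IsUnit (G * Gᵀ)) :
    LinearIndependent F G.row := by
  rw [← vecMul_injective_iff, ← coe_vecMulLinear, injective_iff_map_eq_zero]
  intro y hy
  exact eq_zero_of_mulVec_vecMul_eq_zero hG (by rw [← vecMulLinear_apply, hy, mulVec_zero])

theorem isLCD_span_row_of_isUnit_gram {G : Matrix m (Fin n) F} (hG : IsUnit (G * Gᵀ)) :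
    IsLCD (Submodule.span F (Set.range G.row)) := by
  refine (Submodule.eq_bot_iff _).2 fun x ⟨hxC, hxD⟩ => ?_
  obtain ⟨y, rfl⟩ := mem_span_range_row_iff.1 hxC
  have horth : G *ᵥ (y ᵥ* G) = 0 := by
    funext i
    rw [mulVec, dotProduct_comm]
    exact hxD _ (Submodule.subset_span ⟨i, rfl⟩)
  rw [eq_zero_of_mulVec_vecMul_eq_zero hG horth, zero_vecMul]

theorem isGeneratorMatrix_and_isLCDCode_of_isUnit_gram [DecidableEq F] {k d : ℕ}
    {G : Matrix (Fin k) (Fin n) F} (hG : IsUnit (G * Gᵀ))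
    (hle : ∀ y ≠ 0, d ≤ hammingNorm (y ᵥ* G)) (hattained : ∃ y ≠ 0, hammingNorm (y ᵥ* G) = d) :
    IsGeneratorMatrix G (Submodule.span F (Set.range G.row)) ∧
      IsLCDCode n k d (Submodule.span F (Set.range G.row)) := by
  have hrow := linearIndependent_row_of_isUnit_gram hG
  have hrank := finrank_span_eq_card hrow
  rw [Fintype.card_fin] at hrank
  exact ⟨⟨hrow, rfl⟩, isLCD_span_row_of_isUnit_gram hG, hrank,
    hasMinDist_span_row hrow hle hattained⟩

end GeneratorMatrix

section Examples

theorem isGeneratorMatrix_and_isLCDCode_G1 :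
    IsGeneratorMatrix G1 (Submodule.span (ZMod 3) (Set.range G1.row)) ∧
      IsLCDCode 23 4 14 (Submodule.span (ZMod 3) (Set.range G1.row)) :=
  isGeneratorMatrix_and_isLCDCode_of_isUnit_gram
    (.of_mul_eq_one !![0, 0, 1, 2; 0, 0, 1, 0; 1, 1, 1, 2; 2, 0, 2, 2] (by decide +kernel))
    (by decide +kernel) ⟨![0, 1, 0, 0], by decide +kernel⟩

theorem isGeneratorMatrix_and_isLCDCode_G2 :
    IsGeneratorMatrix G2 (Submodule.span (ZMod 3) (Set.range G2.row)) ∧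
      IsLCDCode 23 5 12 (Submodule.span (ZMod 3) (Set.range G2.row)) :=
  isGeneratorMatrix_and_isLCDCode_of_isUnit_gram
    (.of_mul_eq_one
      !![2, 1, 2, 2, 2; 1, 0, 0, 2, 1; 2, 0, 2, 2, 2; 2, 2, 2, 2, 1; 2, 1, 2, 1, 2]
      (by decide +kernel))
    (by decide +kernel) ⟨![0, 1, 0, 0, 1], by decide +kernel⟩

theorem isGeneratorMatrix_and_isLCDCode_G3 :
    IsGeneratorMatrix G3 (Submodule.span (ZMod 3) (Set.range G3.row)) ∧
      IsLCDCode 24 6 12 (Submodule.span (ZMod 3) (Set.range G3.row)) :=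
  isGeneratorMatrix_and_isLCDCode_of_isUnit_gram
    (.of_mul_eq_one
      !![1, 1, 0, 0, 1, 0; 1, 2, 2, 0, 1, 2; 0, 2, 1, 2, 0, 1;
         0, 0, 2, 1, 1, 0; 1, 1, 0, 1, 2, 1; 0, 2, 1, 0, 1, 1]
      (by decide +kernel))
    (by decide +kernel) ⟨![0, 0, 0, 0, 1, 0], by decide +kernel⟩

theorem isGeneratorMatrix_and_isLCDCode_G4 :
    IsGeneratorMatrix G4 (Submodule.span (ZMod 3) (Set.range G4.row)) ∧
      IsLCDCode 25 5 14 (Submodule.span (ZMod 3) (Set.range G4.row)) :=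
  isGeneratorMatrix_and_isLCDCode_of_isUnit_gram
    (.of_mul_eq_one
      !![1, 2, 0, 0, 0; 2, 2, 1, 2, 1; 0, 1, 1, 0, 2; 0, 2, 0, 1, 1; 0, 1, 2, 1, 1]
      (by decide +kernel))
    (by decide +kernel) ⟨![0, 0, 0, 1, 0], by decide +kernel⟩

end Examples

end LCDCode

theorem mainTheorem3 :
    (∃ C : Submodule (ZMod 3) (Fin 23 → ZMod 3),
      LCDCode.IsGeneratorMatrix LCDCode.G1 C ∧ LCDCode.IsOptimalLCDCode 23 4 14 C) ∧
    (∃ C : Submodule (ZMod 3) (Fin 23 → ZMod 3),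
      LCDCode.IsGeneratorMatrix LCDCode.G2 C ∧ LCDCode.IsLCDCode 23 5 12 C) ∧
    (∃ C : Submodule (ZMod 3) (Fin 24 → ZMod 3),
      LCDCode.IsGeneratorMatrix LCDCode.G3 C ∧ LCDCode.IsLCDCode 24 6 12 C) ∧
    (∃ C : Submodule (ZMod 3) (Fin 25 → ZMod 3),
      LCDCode.IsGeneratorMatrix LCDCode.G4 C ∧ LCDCode.IsLCDCode 25 5 14 C) := by
  obtain ⟨hG, hC⟩ := LCDCode.isGeneratorMatrix_and_isLCDCode_G1
  exact ⟨⟨_, hG, hC, fun _ _ hC' => LCDCode.le_fourteen_of_hasMinDist hC'.2.1 hC'.2.2⟩,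
    ⟨_, LCDCode.isGeneratorMatrix_and_isLCDCode_G2⟩,
    ⟨_, LCDCode.isGeneratorMatrix_and_isLCDCode_G3⟩,
    ⟨_, LCDCode.isGeneratorMatrix_and_isLCDCode_G4⟩⟩
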